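/- Let $p_1,p_2,p_3\in\mathbb R^2$ and $q_1,q_2,q_3\in\mathbb R^2$ be the vertices of two (non-degenerate) equilateral triangles, and put $L_i(t)=\tfrac12(t+p_i)$, $K_i(t)=\tfrac12(t+q_i)$, $i\in I=\{1,2,3\}$. Let $SG'$ and $SG''$ be the Sierpiński gaskets generated by them, i.e. the unique nonempty compact sets with $SG'=\bigcup_i L_i(SG')$ and $SG''=\bigcup_i K_i(SG'')$. Fix $N\ge 1$ and, for words $\omega,\eta\in I^N$, put $L_\omega=L_{\omega_1}\circ\cdots\circ L_{\omega_N}$ and $K_\eta=K_{\eta_1}\circ\cdots\circ K_{\eta_N}$. For $\omega,\eta\in I^N$ let $\alpha_{\omega\eta},h_{\omega\eta}:SG'\times SG''\to\mathbb R$ be Hölder continuous for the Euclidean metric: all $h_{\omega\eta}$ with an exponent $s_h\in(0,1]$ and a constant $K_h$, and $\alpha_{\omega\eta}$ with an exponent $s_{\alpha_{\omega\eta}}\in(0,1]$ and a constant $K_{\alpha_{\omega\eta}}$. Put $$\|\alpha\|_\infty=\max_{\omega,\eta\in I^N}\ \sup_{SG'\times SG''}|\alpha_{\omega\eta}|,\qquad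 s=\min\Big\{s_h,\ \min_{\omega,\eta\in I^N}s_{\alpha_{\omega\eta}}\Big\}.$$ Let $f:SG'\times SG''\to\mathbb R$ be the fractal interpolation function determined by these maps, that is, a function whose graph $Gr(f)=\{(t,u,f(t,u)):(t,u)\in SG'\times SG''\}\subset\mathbb R^2\times\mathbb R^2\times\mathbb R=\mathbb R^5$ is the attractor of the iterated function system $$W_{\omega\eta}(t,u,x)=\big(L_\omega(t),\,K_\eta(u),\,\alpha_{\omega\eta}(t,u)\,x+h_{\omega\eta}(t,u)\big),\qquad \omega,\eta\in I^N,$$ meaning that $Gr(f)$ is compact (equivalently, $f$ is continuous) and $Gr(f)=\bigcup_{\omega,\eta\in I^N}W_{\omega\eta}(Gr(f))$. If $\|\alpha\|_\infty<2^{-N}$, then $$2\,\frac{\log 3}{\log 2}\ \le\ \dim_H Gr(f)\ \le\ \overline{\dim}_B\, Gr(f)\ \le\ 1-s+2\,\frac{\log 3}{\log 2},$$ where $\dim_H$ denotes the Hausdorff dimension and $\overline{\dim}_B$ the upper box dimension. -/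

import Mathlib

open Set Filter Topology
open scoped NNReal ENNReal

noncomputable section

namespace GasketFIF

/-- The Euclidean plane. -/
abbrev Plane : Type := EuclideanSpace ℝ (Fin 2)

/-- The product of two planes, with the Euclidean norm of `ℝ⁴`. -/
abbrev Plane2 : Type := WithLp 2 (Plane × Plane)

/-- The product of two planes and a line, with the Euclidean norm of `ℝ⁵`. -/
abbrev Space5 : Type := WithLp 2 (Plane2 × ℝ)

/-- `K` is an attractor of the iterated function system `W`: a nonempty compact set with
`K = ⋃ i, W i (K)`. -/
def IsAttractor {X ι : Type*} [TopologicalSpace X] (W : ι → X → X) (K : Set X) : Prop :=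
  K.Nonempty ∧ IsCompact K ∧ K = ⋃ i, W i '' K

/-- The contraction `t ↦ (t + p i) / 2` of the plane. -/
def halfMap (p : Fin 3 → Plane) (i : Fin 3) (t : Plane) : Plane := (1 / 2 : ℝ) • (t + p i)

theorem exists_isAttractor_halfMap (p : Fin 3 → Plane) : ∃ K, IsAttractor (halfMap p) K := by
  let g : ℕ → (ℕ → Fin 3) → Plane := fun k ω => ((1 / 2 : ℝ) ^ (k + 1)) • p (ω k)
  have hb : ∀ k ω, ‖g k ω‖ ≤ (1 / 2 : ℝ) ^ k * ∑ i, ‖p i‖ := by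
    intro k ω
    have h1 : ‖p (ω k)‖ ≤ ∑ i, ‖p i‖ :=
      Finset.single_le_sum (f := fun i => ‖p i‖) (fun i _ => norm_nonneg _) (Finset.mem_univ _)
    have h2 : (1 / 2 : ℝ) ^ (k + 1) ≤ (1 / 2 : ℝ) ^ k :=
      pow_le_pow_of_le_one (by norm_num) (by norm_num) (Nat.le_succ k)
    simp only [g, norm_smul, norm_pow]
    rw [Real.norm_of_nonneg (by norm_num : (0 : ℝ) ≤ 1 / 2)]
    gcongr
  have hs : Summable fun k : ℕ => (1 / 2 : ℝ) ^ k * ∑ i, ‖p i‖ :=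
    (summable_geometric_of_lt_one (by norm_num) (by norm_num)).mul_right _
  have hgs : ∀ ω, Summable fun k => g k ω := fun ω => .of_norm_bounded hs fun k => hb k ω
  have hcont : Continuous fun ω => ∑' k, g k ω := by
    refine continuous_tsum (fun k => ?_) hs hb
    have hp : Continuous p := continuous_of_discreteTopology
    have hk : Continuous fun ω : ℕ → Fin 3 => ω k := continuous_apply k
    exact (hp.comp hk).const_smul ((1 / 2 : ℝ) ^ (k + 1))
  have hstep : ∀ ω, ∑' k, g k ω = halfMap p (ω 0) (∑' k, g k fun n => ω (n + 1)) := by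
    intro ω
    rw [(hgs ω).tsum_eq_zero_add, halfMap, smul_add, ← tsum_const_smul'', add_comm]
    congr 1
    · refine tsum_congr fun k => ?_
      simp only [g, smul_smul]
      congr 1
      ring
    · simp [g]
  refine ⟨range fun ω => ∑' k, g k ω, range_nonempty _, isCompact_range hcont, ?_⟩
  ext x
  simp only [mem_range, mem_iUnion, mem_image, exists_exists_eq_and]
  constructor
  · rintro ⟨ω, rfl⟩
    exact ⟨ω 0, fun n => ω (n + 1), (hstep ω).symm⟩
  · rintro ⟨i, ω, rfl⟩
    exact ⟨fun n => Nat.casesOn n i ω, hstep _⟩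

/-- The Sierpinski gasket with vertices `p`: the attractor of the three maps `halfMap p i`. -/
def gasket (p : Fin 3 → Plane) : Set Plane := Classical.choose (exists_isAttractor_halfMap p)

theorem isAttractor_gasket (p : Fin 3 → Plane) : IsAttractor (halfMap p) (gasket p) :=
  Classical.choose_spec (exists_isAttractor_halfMap p)

theorem IsAttractor.subset_of_halfMap {p : Fin 3 → Plane} {K K' : Set Plane}
    (hK : IsAttractor (halfMap p) K) (hK' : IsAttractor (halfMap p) K') : K ⊆ K' := by
  obtain ⟨x, hx, hmax⟩ := hK.2.1.exists_isMaxOn hK.1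
    (f := fun x => Metric.infDist x K') (Metric.continuous_infDist_pt K').continuousOn
  have h0 : Metric.infDist x K' ≤ 0 := by
    have hx' := hx
    rw [hK.2.2] at hx'
    obtain ⟨i, y, hy, rfl⟩ := mem_iUnion.1 hx'
    obtain ⟨z, hz, hyz⟩ := hK'.2.1.exists_infDist_eq_dist hK'.1 y
    have hz' : halfMap p i z ∈ K' := by
      rw [hK'.2.2]
      exact mem_iUnion.2 ⟨i, z, hz, rfl⟩
    have h1 := Metric.infDist_le_dist_of_mem (x := halfMap p i y) hz'
    have h2 : dist (halfMap p i y) (halfMap p i z) = 1 / 2 * dist y z := by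
      rw [halfMap, halfMap, dist_smul₀, dist_add_right, Real.norm_of_nonneg (by norm_num)]
    have h3 : Metric.infDist y K' ≤ Metric.infDist (halfMap p i y) K' := hmax hy
    linarith
  intro w hw
  have h1 : Metric.infDist w K' ≤ Metric.infDist x K' := hmax hw
  exact (hK'.2.1.isClosed.mem_iff_infDist_zero hK'.1).2
    (le_antisymm (h1.trans h0) Metric.infDist_nonneg)

/-- The gasket is the only attractor of its system. -/
theorem IsAttractor.eq_gasket {p : Fin 3 → Plane} {K : Set Plane}
    (hK : IsAttractor (halfMap p) K) : K = gasket p :=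
  (hK.subset_of_halfMap (isAttractor_gasket p)).antisymm
    ((isAttractor_gasket p).subset_of_halfMap hK)

/-- Words of length `N` over a three-letter alphabet. -/
abbrev Word (N : ℕ) : Type := Fin N → Fin 3

/-- The composition `L_{ω₁} ∘ L_{ω₂} ∘ ⋯ ∘ L_{ω_N}` of the maps `halfMap p i`. -/
def wordMap (p : Fin 3 → Plane) {N : ℕ} (ω : Word N) (t : Plane) : Plane :=
  (List.ofFn ω).foldr (halfMap p) t

/-- The product of the gaskets with vertices `p` and `q`. -/
def gasketProd (p q : Fin 3 → Plane) : Set Plane2 :=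
  {x | x.fst ∈ gasket p ∧ x.snd ∈ gasket q}

/-- The iterated function system
`W_{ωη}(t, s, x) = (L_ω(t), K_η(s), α_{ωη}(t, s) x + h_{ωη}(t, s))`, indexed by pairs of words
of length `N`. -/
def fifSystem (p q : Fin 3 → Plane) {N : ℕ} (α h : Word N × Word N → Plane2 → ℝ)
    (w : Word N × Word N) (x : Space5) : Space5 :=
  WithLp.toLp 2 (WithLp.toLp 2 (wordMap p w.1 x.fst.fst, wordMap q w.2 x.fst.snd),
    α w x.fst * x.snd + h w x.fst)

/-- The graph of `f` over `A`. -/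
def graphOver (A : Set Plane2) (f : Plane2 → ℝ) : Set Space5 :=
  (fun y => WithLp.toLp 2 (y, f y)) '' A

/-- `f`, restricted to the product of the gaskets, is the fractal interpolation function of the
system: its graph is the attractor. Compactness of the graph makes `f` continuous there. -/
def IsFIF (p q : Fin 3 → Plane) {N : ℕ} (α h : Word N × Word N → Plane2 → ℝ)
    (f : Plane2 → ℝ) : Prop :=
  IsAttractor (fifSystem p q α h) (graphOver (gasketProd p q) f)

/-- The maximum over all `w` of the supremum norms of `α w` on `A`. -/
def supNorm {N : ℕ} (A : Set Plane2) (α : Word N × Word N → Plane2 → ℝ) : ℝ :=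
  ⨆ w, ⨆ y : A, |α w y|

/-- The upper box dimension `limsup_{δ → 0+} log N_δ(A) / (-log δ)`, where `N_δ(A)` is the least
number of closed balls of radius `δ` that cover `A`. -/
def upperBoxDim {X : Type*} [PseudoEMetricSpace X] (A : Set X) : EReal :=
  limsup (fun δ : ℝ≥0 => ENNReal.log (Metric.externalCoveringNumber δ A : ℝ≥0∞) /
    ((-Real.log δ : ℝ) : EReal)) (𝓝[>] 0)

end GasketFIF

end

open GasketFIF

/-!
Lower bound: the graph projects onto the product of the two gaskets. In barycentric coordinates
this product consists of the points whose binary digits form an arbitrary sequence of nine digit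
vectors, so it carries the image of a Bernoulli measure, which gives a dyadic cube of side `2⁻ⁿ`
mass `O(9⁻ⁿ)`. The mass distribution principle yields `dim_H ≥ log 9 / log 2`.

Upper bound: put `ρ = 2⁻ᴺ`. One step of the functional equation multiplies an oscillation of `f` by
at most `‖α‖_∞` and adds the Hölder error of `α` and `h`. Since `‖α‖_∞ < ρ ≤ ρˢ`, the oscillation
over a cell of level `n`, whose diameter is `O(ρⁿ)`, is `O(ρⁿˢ)`. Hence `O(ρ^(n(s - 1)))` balls of
radius `ρⁿ` cover the graph over each of the `9^(Nn)` cells of level `n`.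
-/

namespace GasketFIF

section BoxDimension

open Metric MeasureTheory

variable {X : Type*}

theorem exists_isCover_encard_eq [PseudoEMetricSpace X] (δ : ℝ≥0) (A : Set X) :
    ∃ C : Set X, IsCover δ A C ∧ C.encard = externalCoveringNumber δ A := by
  have : Nonempty {C : Set X // IsCover δ A C} := ⟨⟨A, .rfl⟩⟩
  obtain ⟨⟨C, hC⟩, hcard⟩ := ENat.exists_eq_iInf fun C : {C : Set X // IsCover δ A C} =>
    (C : Set X).encard
  rw [iInf_subtype, ← externalCoveringNumber] at hcard
  exact ⟨C, hC, hcard⟩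

theorem externalCoveringNumber_iUnion_le [PseudoEMetricSpace X] {ι : Type*} [Fintype ι] (δ : ℝ≥0)
    (A : ι → Set X) :
    externalCoveringNumber δ (⋃ i, A i) ≤ ∑ i, externalCoveringNumber δ (A i) := by
  choose C hC hcard using fun i => exists_isCover_encard_eq δ (A i)
  have hcover : IsCover δ (⋃ i, A i) (⋃ i, C i) := by
    rintro x hx
    obtain ⟨i, hi⟩ := mem_iUnion.1 hx
    obtain ⟨c, hc, hxc⟩ := hC i hi
    exact ⟨c, mem_iUnion.2 ⟨i, hc⟩, hxc⟩
  calc externalCoveringNumber δ (⋃ i, A i) ≤ (⋃ i, C i).encard :=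
        hcover.externalCoveringNumber_le_encard
    _ ≤ ∑ i, (C i).encard := encard_iUnion_le_of_fintype C
    _ = ∑ i, externalCoveringNumber δ (A i) := by simp only [hcard]

theorem hausdorffMeasure_le_of_eventually_externalCoveringNumber_mul_le [EMetricSpace X]
    [MeasurableSpace X] [BorelSpace X] {A : Set X} {d : ℝ} (hd : 0 ≤ d) {M : ℝ≥0∞}
    (hA : ∀ᶠ δ : ℝ≥0 in 𝓝[>] 0,
      (externalCoveringNumber δ A : ℝ≥0∞) * (2 * (δ : ℝ≥0∞)) ^ d ≤ M) :
    Measure.hausdorffMeasure d A ≤ M := by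
  rcases eq_or_ne M ⊤ with rfl | hM
  · exact le_top
  have hcover : ∀ᶠ δ : ℝ≥0 in 𝓝[>] 0, ∃ C : Finset X,
      IsCover δ A (C : Set X) ∧ (C.card : ℝ≥0∞) * (2 * (δ : ℝ≥0∞)) ^ d ≤ M := by
    filter_upwards [hA, self_mem_nhdsWithin] with δ hδ hδ0
    have hpow : (2 * (δ : ℝ≥0∞)) ^ d ≠ 0 := by
      have : (0 : ℝ≥0∞) < δ := by exact_mod_cast hδ0
      exact (ENNReal.rpow_pos (by positivity) (by finiteness)).ne'
    have hfin : externalCoveringNumber δ A ≠ ⊤ := by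
      intro htop
      rw [htop, ENat.toENNReal_top, ENNReal.top_mul hpow, top_le_iff] at hδ
      exact hM hδ
    obtain ⟨C, hC, hcard⟩ := exists_isCover_encard_eq δ A
    have hCfin : C.Finite := encard_ne_top_iff.1 (hcard ▸ hfin)
    refine ⟨hCfin.toFinset, by simpa using hC, ?_⟩
    rwa [← hcard, hCfin.encard_eq_coe_toFinset_card, ENat.toENNReal_coe] at hδ
  obtain ⟨C, hC⟩ := hcover.choice
  have hdiam : Tendsto (fun δ : ℝ≥0 => 2 * (δ : ℝ≥0∞)) (𝓝[>] 0) (𝓝 0) := by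
    have : Continuous fun δ : ℝ≥0 => ((2 * δ : ℝ≥0) : ℝ≥0∞) := by fun_prop
    simpa using (this.tendsto 0).mono_left nhdsWithin_le_nhds
  calc Measure.hausdorffMeasure d A
      ≤ liminf (fun δ : ℝ≥0 => ∑ c : C δ, ediam (closedEBall (c : X) δ) ^ d) (𝓝[>] 0) := by
        refine Measure.hausdorffMeasure_le_liminf_sum d A _ hdiam _
          (.of_forall fun _ _ => ediam_closedEBall_le) ?_
        filter_upwards [hC] with δ hδ
        simpa [iUnion_subtype] using isCover_iff_subset_iUnion_closedEBall.1 hδ.1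
    _ ≤ liminf (fun _ : ℝ≥0 => M) (𝓝[>] 0) := by
        refine liminf_le_liminf ?_
        filter_upwards [hC] with δ hδ
        calc ∑ c : C δ, ediam (closedEBall (c : X) δ) ^ d
            ≤ ∑ _c : C δ, (2 * (δ : ℝ≥0∞)) ^ d := by
              gcongr
              exact ediam_closedEBall_le
          _ = (C δ).card * (2 * (δ : ℝ≥0∞)) ^ d := by simp
          _ ≤ M := hδ.2
    _ = M := liminf_const M

theorem upperBoxDim_nonneg [PseudoEMetricSpace X] {A : Set X} (hA : A.Nonempty) :
    0 ≤ upperBoxDim A := by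
  have hquot : ∀ᶠ δ : ℝ≥0 in 𝓝[>] 0, (0 : EReal) ≤
      ENNReal.log (externalCoveringNumber δ A : ℝ≥0∞) / ((-Real.log δ : ℝ) : EReal) := by
    filter_upwards [Ioo_mem_nhdsGT (zero_lt_one' ℝ≥0)] with δ hδ
    refine EReal.div_nonneg (ENNReal.zero_le_log_iff.2 ?_) ?_
    · exact_mod_cast Order.one_le_iff_pos.2 (externalCoveringNumber_pos_iff.2 hA)
    · exact_mod_cast neg_nonneg.2 (Real.log_nonpos δ.coe_nonneg (by exact_mod_cast hδ.2.le))
  calc (0 : EReal) = limsup (fun _ : ℝ≥0 => (0 : EReal)) (𝓝[>] 0) := (limsup_const 0).symm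
    _ ≤ upperBoxDim A := limsup_le_limsup hquot

theorem eventually_externalCoveringNumber_le_rpow_neg [PseudoEMetricSpace X] {A : Set X} {d : ℝ}
    (hd : upperBoxDim A < d) :
    ∀ᶠ δ : ℝ≥0 in 𝓝[>] 0, (externalCoveringNumber δ A : ℝ≥0∞) ≤ (δ : ℝ≥0∞) ^ (-d) := by
  filter_upwards [Ioo_mem_nhdsGT (zero_lt_one' ℝ≥0), eventually_lt_of_limsup_lt hd] with δ hδ h
  have hlog : 0 < -Real.log δ :=
    neg_pos.2 (Real.log_neg (by exact_mod_cast hδ.1) (by exact_mod_cast hδ.2))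
  rw [EReal.div_lt_iff (by exact_mod_cast hlog) (EReal.coe_ne_top _)] at h
  rw [← ENNReal.log_le_log_iff, ENNReal.log_rpow, ENNReal.log_of_nnreal hδ.1.ne']
  refine h.le.trans_eq ?_
  norm_cast
  ring

theorem dimH_le_upperBoxDim [EMetricSpace X] {A : Set X} (hA : A.Nonempty) :
    (dimH A : EReal) ≤ upperBoxDim A := by
  borelize X
  refine le_of_forall_gt_imp_ge_of_dense fun x hx => ?_
  induction x with
  | bot => exact absurd hx not_lt_bot
  | top => exact le_top
  | coe d =>
    have hd : 0 ≤ d := by exact_mod_cast (upperBoxDim_nonneg hA).trans hx.le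
    lift d to ℝ≥0 using hd
    have hmeasure : Measure.hausdorffMeasure (d : ℝ) A ≤ 2 ^ (d : ℝ) := by
      refine hausdorffMeasure_le_of_eventually_externalCoveringNumber_mul_le d.coe_nonneg ?_
      filter_upwards [eventually_externalCoveringNumber_le_rpow_neg hx, self_mem_nhdsWithin]
        with δ hδ hδ0
      have hδ0' : (δ : ℝ≥0∞) ≠ 0 := by exact_mod_cast (mem_Ioi.1 hδ0).ne'
      calc (externalCoveringNumber δ A : ℝ≥0∞) * (2 * (δ : ℝ≥0∞)) ^ (d : ℝ)
          ≤ (δ : ℝ≥0∞) ^ (-(d : ℝ)) * (2 ^ (d : ℝ) * (δ : ℝ≥0∞) ^ (d : ℝ)) := by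
            rw [ENNReal.mul_rpow_of_nonneg _ _ d.coe_nonneg]
            gcongr
        _ = 2 ^ (d : ℝ) := by
            rw [mul_left_comm, ← ENNReal.rpow_add _ _ hδ0' ENNReal.coe_ne_top]
            simp
    exact EReal.coe_ennreal_le_coe_ennreal_iff.2 (dimH_le_of_hausdorffMeasure_ne_top
      (ne_top_of_le_ne_top (by finiteness) hmeasure))

theorem upperBoxDim_le_of_eventually_externalCoveringNumber_le [PseudoEMetricSpace X] {A : Set X}
    {C d : ℝ} (hC : 0 < C) (h : ∀ᶠ δ : ℝ≥0 in 𝓝[>] 0,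
      (externalCoveringNumber δ A : ℝ≥0∞) ≤ ENNReal.ofReal (C * (δ : ℝ) ^ (-d))) :
    upperBoxDim A ≤ d := by
  have hlog : Tendsto (fun δ : ℝ≥0 => -Real.log δ) (𝓝[>] 0) atTop := by
    refine tendsto_neg_atBot_atTop.comp (Real.tendsto_log_nhdsGT_zero.comp
      (tendsto_nhdsWithin_iff.2 ⟨?_, ?_⟩))
    · exact (NNReal.continuous_coe.tendsto 0).mono_left nhdsWithin_le_nhds
    · filter_upwards [self_mem_nhdsWithin] with δ hδ
      exact_mod_cast hδ
  have hlim : Tendsto (fun δ : ℝ≥0 => ((Real.log C / (-Real.log δ) + d : ℝ) : EReal)) (𝓝[>] 0)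
      (𝓝 (d : EReal)) := by
    refine (continuous_coe_real_ereal.tendsto d).comp ?_
    simpa using (hlog.const_div_atTop (Real.log C)).add_const d
  rw [← hlim.limsup_eq]
  refine limsup_le_limsup ?_
  filter_upwards [self_mem_nhdsWithin, hlog.eventually_gt_atTop 0, h] with δ hδ hpos hle
  have hδ0 : (0 : ℝ) < δ := by exact_mod_cast hδ
  rw [EReal.div_le_iff_le_mul (by exact_mod_cast hpos) (EReal.coe_ne_top _), ← EReal.coe_mul]
  refine (ENNReal.log_le_log hle).trans_eq ?_
  rw [ENNReal.log_ofReal_of_pos (by positivity), Real.log_mul hC.ne' (by positivity),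
    Real.log_rpow hδ0, mul_add, mul_div_cancel₀ _ hpos.ne']
  congr 1
  ring

end BoxDimension

section MassDistribution

open Metric MeasureTheory

variable {X : Type*} [EMetricSpace X] [MeasurableSpace X] [BorelSpace X] {μ : Measure X}
  {C d : ℝ≥0}

theorem inv_smul_le_hausdorffMeasure
    (hμ : ∀ x, ∀ r : ℝ≥0, 0 < r → r ≤ 1 → μ (closedEBall x r) ≤ C * (r : ℝ≥0∞) ^ (d : ℝ)) :
    (C : ℝ≥0∞)⁻¹ • μ ≤ Measure.hausdorffMeasure (d : ℝ) := by
  refine Measure.le_hausdorffMeasure _ _ (1 / 2) (by norm_num) fun S hS => ?_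
  have hbound : μ S ≤ C * ediam S ^ (d : ℝ) := by
    rcases S.eq_empty_or_nonempty with rfl | ⟨x, hx⟩
    · simp
    lift ediam S to ℝ≥0 using ne_top_of_le_ne_top (by finiteness) hS with δ hδ
    have hδ1 : δ < 1 :=
      ENNReal.coe_lt_one_iff.1 (hS.trans_lt (ENNReal.div_lt_of_lt_mul (by norm_num)))
    have hlim : Tendsto (fun r : ℝ≥0 => C * (r : ℝ≥0∞) ^ (d : ℝ)) (𝓝[>] δ)
        (𝓝 (C * (δ : ℝ≥0∞) ^ (d : ℝ))) := by
      have hcont : Continuous fun r : ℝ≥0 => (r : ℝ≥0∞) ^ (d : ℝ) :=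
        ENNReal.continuous_rpow_const.comp ENNReal.continuous_coe
      exact ENNReal.Tendsto.const_mul ((hcont.tendsto δ).mono_left nhdsWithin_le_nhds)
        (Or.inr ENNReal.coe_ne_top)
    refine ge_of_tendsto hlim ?_
    filter_upwards [Ioo_mem_nhdsGT hδ1] with r hr
    refine (measure_mono fun y hy => ?_).trans (hμ x r hr.1.bot_lt hr.2.le)
    exact (edist_le_ediam_of_mem hy hx).trans (hδ ▸ by exact_mod_cast hr.1.le)
  calc (C : ℝ≥0∞)⁻¹ * μ S ≤ (C : ℝ≥0∞)⁻¹ * (C * ediam S ^ (d : ℝ)) := by gcongr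
    _ ≤ ediam S ^ (d : ℝ) := by
      rw [← mul_assoc]
      exact mul_le_of_le_one_left' (ENNReal.inv_mul_le_one C)

theorem le_dimH_of_measure_closedEBall_le
    (hμ : ∀ x, ∀ r : ℝ≥0, 0 < r → r ≤ 1 → μ (closedEBall x r) ≤ C * (r : ℝ≥0∞) ^ (d : ℝ))
    {A : Set X} (hA : μ A ≠ 0) : (d : ℝ≥0∞) ≤ dimH A := by
  refine le_dimH_of_hausdorffMeasure_ne_zero (ne_bot_of_le_ne_bot ?_
    (inv_smul_le_hausdorffMeasure hμ A))
  exact mul_ne_zero (ENNReal.inv_ne_zero.2 ENNReal.coe_ne_top) hA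

theorem le_dimH_of_measure_closedEBall_pow_le {β : ℝ≥0} (hβ0 : 0 < β) (hβ1 : β < 1)
    (hμ : ∀ x, ∀ n : ℕ, μ (closedEBall x (β ^ n : ℝ≥0)) ≤ C * ((β ^ (d : ℝ)) ^ n : ℝ≥0))
    {A : Set X} (hA : μ A ≠ 0) : (d : ℝ≥0∞) ≤ dimH A := by
  refine le_dimH_of_measure_closedEBall_le (C := C * (β ^ (d : ℝ))⁻¹) (fun x r hr0 hr1 => ?_) hA
  obtain ⟨n, hlt, hle⟩ := exists_nat_pow_near_of_lt_one hr0 hr1 hβ0 hβ1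
  have hβd : (β ^ (d : ℝ)) ≠ 0 := (NNReal.rpow_pos hβ0).ne'
  have hpow : (β ^ (d : ℝ)) ^ (n + 1) ≤ r ^ (d : ℝ) := by
    rw [← NNReal.rpow_natCast, ← NNReal.rpow_mul, mul_comm, NNReal.rpow_mul, NNReal.rpow_natCast]
    gcongr
  have hscale : C * (β ^ (d : ℝ)) ^ n ≤ C * (β ^ (d : ℝ))⁻¹ * r ^ (d : ℝ) := by
    calc C * (β ^ (d : ℝ)) ^ n = C * (β ^ (d : ℝ))⁻¹ * (β ^ (d : ℝ)) ^ (n + 1) := by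
          rw [pow_succ]
          field_simp
      _ ≤ C * (β ^ (d : ℝ))⁻¹ * r ^ (d : ℝ) := by gcongr
  calc μ (closedEBall x r) ≤ μ (closedEBall x (β ^ n : ℝ≥0)) :=
        measure_mono (closedEBall_subset_closedEBall (by exact_mod_cast hle))
    _ ≤ C * ((β ^ (d : ℝ)) ^ n : ℝ≥0) := hμ x n
    _ ≤ (C * (β ^ (d : ℝ))⁻¹ : ℝ≥0) * (r : ℝ≥0∞) ^ (d : ℝ) := by
        rw [← ENNReal.coe_rpow_of_nonneg _ d.coe_nonneg]
        exact_mod_cast hscale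

end MassDistribution

section SelfSimilar

open Metric

theorem subset_of_subset_iUnion_image {X ι : Type*} [PseudoMetricSpace X] {S : ι → X → X}
    {ρ : ℝ≥0} (hρ : ρ < 1) (hS : ∀ i, LipschitzWith ρ (S i)) {B G : Set X}
    (hB : Bornology.IsBounded B) (hBS : B ⊆ ⋃ i, S i '' B) (hne : G.Nonempty) (hG : IsClosed G)
    (hGS : ∀ i, MapsTo (S i) G G) : B ⊆ G := by
  obtain ⟨g, hg⟩ := hne
  obtain ⟨M, hM⟩ := hB.subset_closedBall g
  have hM0 : ∀ x ∈ B, infDist x G ≤ M := fun x hx => (infDist_le_dist_of_mem hg).trans (hM hx)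
  have hcontract : ∀ i x, infDist (S i x) G ≤ ρ * infDist x G := by
    intro i x
    refine le_of_forall_pos_le_add fun ε hε => ?_
    obtain ⟨y, hy, hxy⟩ := (infDist_lt_iff ⟨g, hg⟩).1 (lt_add_of_pos_right (infDist x G) hε)
    calc infDist (S i x) G ≤ dist (S i x) (S i y) := infDist_le_dist_of_mem (hGS i hy)
      _ ≤ ρ * dist x y := (hS i).dist_le_mul x y
      _ ≤ ρ * (infDist x G + ε) := by gcongr
      _ ≤ ρ * infDist x G + ε := by
        rw [mul_add]
        gcongr
        exact mul_le_of_le_one_left hε.le (by exact_mod_cast hρ.le)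
  have hdist : ∀ n : ℕ, ∀ x ∈ B, infDist x G ≤ ρ ^ n * M := by
    intro n
    induction n with
    | zero => simpa using hM0
    | succ n ih =>
      intro x hx
      obtain ⟨i, y, hy, rfl⟩ := mem_iUnion.1 (hBS hx)
      calc infDist (S i y) G ≤ ρ * infDist y G := hcontract i y
        _ ≤ ρ * (ρ ^ n * M) := by gcongr; exact ih y hy
        _ = ρ ^ (n + 1) * M := by ring
  intro x hx
  have hlim : Tendsto (fun n : ℕ => (ρ : ℝ) ^ n * M) atTop (𝓝 0) := by
    simpa using (tendsto_pow_atTop_nhds_zero_of_lt_one ρ.coe_nonneg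
      (by exact_mod_cast hρ)).mul_const M
  exact (hG.mem_iff_infDist_zero ⟨g, hg⟩).2
    (le_antisymm (ge_of_tendsto' hlim fun n => hdist n x hx) infDist_nonneg)

end SelfSimilar

section Digits

variable {b : ℕ}

/-- The integer whose base `b` digits, most significant first, are `a 0, …, a (n - 1)`. -/
def digitPrefix (a : ℕ → Fin b) : ℕ → ℕ
  | 0 => 0
  | n + 1 => b * digitPrefix a n + a n

theorem eq_of_digitPrefix_eq {a a' : ℕ → Fin b} {n : ℕ} (h : digitPrefix a n = digitPrefix a' n) :
    ∀ k < n, a k = a' k := by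
  induction n with
  | zero => simp
  | succ n ih =>
    have hb : 0 < b := Fin.pos (a 0)
    have hlast : a n = a' n := by
      have := congrArg (· % b) h
      simpa [digitPrefix, Nat.mul_add_mod, Nat.mod_eq_of_lt, Fin.val_inj] using this
    have hinit : digitPrefix a n = digitPrefix a' n := by
      simpa [digitPrefix, hlast, hb.ne'] using h
    intro k hk
    rcases Nat.lt_succ_iff_lt_or_eq.1 hk with hk | rfl
    exacts [ih hinit k hk, hlast]

theorem mul_ofDigits (a : ℕ → Fin b) :
    b * Real.ofDigits a = a 0 + Real.ofDigits fun k => a (k + 1) := by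
  have hb : (b : ℝ) ≠ 0 := by exact_mod_cast (Fin.pos (a 0)).ne'
  rw [Real.ofDigits_eq_sum_add_ofDigits a 1]
  simp only [Finset.range_one, Real.ofDigitsTerm, Finset.sum_singleton, zero_add, pow_one]
  field_simp

theorem pow_mul_ofDigits (a : ℕ → Fin b) (n : ℕ) :
    b ^ n * Real.ofDigits a = digitPrefix a n + Real.ofDigits fun k => a (k + n) := by
  induction n with
  | zero => simp [digitPrefix]
  | succ n ih =>
    have hstep := mul_ofDigits fun k => a (k + n)
    rw [zero_add] at hstep
    rw [pow_succ', mul_assoc, ih, mul_add, hstep, digitPrefix]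
    push_cast
    simp only [add_assoc, add_comm 1 n]

theorem digitPrefix_mem_Icc_of_abs_ofDigits_sub_le {a : ℕ → Fin b} {n : ℕ} {x : ℝ}
    (hx : |Real.ofDigits a - x| ≤ ((b : ℝ) ^ n)⁻¹) :
    (digitPrefix a n : ℤ) ∈ Finset.Icc (⌊b ^ n * x⌋ - 2) (⌊b ^ n * x⌋ + 1) := by
  have hb : (0 : ℝ) < b := by exact_mod_cast Fin.pos (a 0)
  have hscaled : |b ^ n * Real.ofDigits a - b ^ n * x| ≤ 1 := by
    rw [← mul_sub, abs_mul, abs_of_pos (by positivity)]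
    calc (b : ℝ) ^ n * |Real.ofDigits a - x| ≤ b ^ n * ((b : ℝ) ^ n)⁻¹ := by gcongr
      _ = 1 := mul_inv_cancel₀ (by positivity)
  rw [abs_le, pow_mul_ofDigits] at hscaled
  have htail0 := Real.ofDigits_nonneg fun k => a (k + n)
  have htail1 := Real.ofDigits_le_one fun k => a (k + n)
  have hfloor := Int.floor_le (b ^ n * x)
  have hlower : ((⌊b ^ n * x⌋ - 2 : ℤ) : ℝ) ≤ digitPrefix a n := by
    push_cast
    linarith
  have hupper : (digitPrefix a n : ℤ) - 1 ≤ ⌊b ^ n * x⌋ := by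
    rw [Int.le_floor]
    push_cast
    linarith
  rw [Finset.mem_Icc]
  exact ⟨by exact_mod_cast hlower, by linarith⟩

end Digits

section DigitPoints

open Metric MeasureTheory

variable {D ι : Type*} {b : ℕ}

/-- The contraction `x ↦ (x + e c) / b` of `ℝ^ι`, which prepends the digit vector `e c` to the base
`b` expansions of the coordinates. -/
noncomputable def digitMap (e : D → ι → Fin b) (c : D) (x : ι → ℝ) : ι → ℝ :=
  fun i => (x i + e c i) / b

/-- The point whose `i`-th coordinate has the base `b` digits `e (ω 0) i, e (ω 1) i, …`; the set of
these points is the attractor of the maps `digitMap e c`. -/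
noncomputable def digitPoint (e : D → ι → Fin b) (ω : ℕ → D) : ι → ℝ :=
  fun i => Real.ofDigits fun n => e (ω n) i

theorem digitPoint_eq_digitMap (e : D → ι → Fin b) (ω : ℕ → D) :
    digitPoint e ω = digitMap e (ω 0) (digitPoint e fun n => ω (n + 1)) := by
  funext i
  have hb : (b : ℝ) ≠ 0 := by exact_mod_cast (Fin.pos (e (ω 0) i)).ne'
  rw [digitMap, eq_div_iff hb, mul_comm, add_comm]
  exact mul_ofDigits fun n => e (ω n) i

theorem lipschitzWith_digitMap [Fintype ι] (e : D → ι → Fin b) (c : D) :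
    LipschitzWith (b : ℝ≥0)⁻¹ (digitMap e c) := by
  refine LipschitzWith.of_dist_le_mul fun x y => (dist_pi_le_iff (by positivity)).2 fun i => ?_
  rw [digitMap, digitMap, Real.dist_eq, ← sub_div, add_sub_add_right_eq_sub, abs_div,
    Nat.abs_cast, div_eq_inv_mul]
  push_cast
  gcongr
  exact dist_le_pi_dist x y i

theorem range_digitPoint_subset [Finite ι] (hb : 1 < b) {e : D → ι → Fin b}
    {G : Set (ι → ℝ)} (hne : G.Nonempty) (hG : IsClosed G) (hGe : ∀ c, MapsTo (digitMap e c) G G) :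
    range (digitPoint e) ⊆ G := by
  have := Fintype.ofFinite ι
  refine subset_of_subset_iUnion_image (inv_lt_one_of_one_lt₀ (by exact_mod_cast hb))
    (lipschitzWith_digitMap e) ((isBounded_Icc (0 : ι → ℝ) 1).subset ?_) ?_ hne hG hGe
  · rintro _ ⟨ω, rfl⟩
    exact ⟨fun i => Real.ofDigits_nonneg _, fun i => Real.ofDigits_le_one _⟩
  · rintro _ ⟨ω, rfl⟩
    exact mem_iUnion.2 ⟨ω 0, digitPoint e fun n => ω (n + 1), mem_range_self _,
      (digitPoint_eq_digitMap e ω).symm⟩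

theorem measurable_digitPoint [Countable D] [MeasurableSpace D] [MeasurableSingletonClass D]
    (e : D → ι → Fin b) : Measurable (digitPoint e) := by
  refine measurable_pi_lambda _ fun i => Real.continuous_ofDigits.measurable.comp ?_
  exact measurable_pi_lambda _ fun n =>
    (measurable_of_countable fun c => e c i).comp (measurable_pi_apply n)

/-- The law of a sequence of independent uniformly distributed letters. -/
noncomputable def bernoulli (D : Type*) [Fintype D] [Nonempty D] [MeasurableSpace D] :
    Measure (ℕ → D) :=
  Measure.infinitePi fun _ => (PMF.uniformOfFintype D).toMeasure

instance [Fintype D] [Nonempty D] [MeasurableSpace D] : IsProbabilityMeasure (bernoulli D) :=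
  inferInstanceAs (IsProbabilityMeasure (Measure.infinitePi _))

section Bernoulli

variable [Fintype D] [Nonempty D] [MeasurableSpace D] [MeasurableSingletonClass D]

theorem bernoulli_cylinder (ω : ℕ → D) (n : ℕ) :
    bernoulli D {ω' | ∀ k < n, ω' k = ω k} = ((Fintype.card D : ℝ≥0∞)⁻¹) ^ n := by
  have hpi : {ω' : ℕ → D | ∀ k < n, ω' k = ω k} = Set.pi (Finset.range n) fun k => {ω k} := by
    ext
    simp
  rw [hpi, bernoulli, Measure.infinitePi_pi _ fun _ _ => measurableSet_singleton _]
  simp only [PMF.toMeasure_apply_singleton _ _ (measurableSet_singleton _),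
    PMF.uniformOfFintype_apply, Finset.prod_const, Finset.card_range]

theorem bernoulli_digitPrefix_eq_le {e : D → ι → Fin b} (he : Function.Injective e) (n : ℕ)
    (v : ι → ℤ) :
    bernoulli D {ω | ∀ i, (digitPrefix (fun k => e (ω k) i) n : ℤ) = v i} ≤
      ((Fintype.card D : ℝ≥0∞)⁻¹) ^ n := by
  rcases eq_empty_or_nonempty {ω : ℕ → D | ∀ i, (digitPrefix (fun k => e (ω k) i) n : ℤ) = v i}
    with hempty | ⟨ω, hω⟩
  · simp [hempty]
  · rw [← bernoulli_cylinder ω n]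
    refine measure_mono fun ω' hω' k hk => he (funext fun i => ?_)
    exact eq_of_digitPrefix_eq (by exact_mod_cast (hω' i).trans (hω i).symm) k hk

theorem bernoulli_preimage_closedBall_le [Fintype ι] {e : D → ι → Fin b}
    (he : Function.Injective e) (x : ι → ℝ) (n : ℕ) :
    bernoulli D (digitPoint e ⁻¹' closedBall x ((b : ℝ) ^ n)⁻¹) ≤
      4 ^ Fintype.card ι * ((Fintype.card D : ℝ≥0∞)⁻¹) ^ n := by
  classical
  let V : Finset (ι → ℤ) :=
    Fintype.piFinset fun i => Finset.Icc (⌊b ^ n * x i⌋ - 2) (⌊b ^ n * x i⌋ + 1)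
  have hV : V.card = 4 ^ Fintype.card ι := by
    have hIcc : ∀ z : ℤ, (z + 1 + 1 - (z - 2)).toNat = 4 := by lia
    simp [V, Fintype.card_piFinset, hIcc]
  have hsub : digitPoint e ⁻¹' closedBall x ((b : ℝ) ^ n)⁻¹ ⊆
      ⋃ v ∈ V, {ω | ∀ i, (digitPrefix (fun k => e (ω k) i) n : ℤ) = v i} := by
    intro ω hω
    refine mem_biUnion (Fintype.mem_piFinset.2 fun i => ?_) fun i => rfl
    exact digitPrefix_mem_Icc_of_abs_ofDigits_sub_le
      ((dist_le_pi_dist (digitPoint e ω) x i).trans hω)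
  calc bernoulli D (digitPoint e ⁻¹' closedBall x ((b : ℝ) ^ n)⁻¹)
      ≤ ∑ v ∈ V, bernoulli D {ω | ∀ i, (digitPrefix (fun k => e (ω k) i) n : ℤ) = v i} :=
        (measure_mono hsub).trans (measure_biUnion_finset_le _ _)
    _ ≤ ∑ _v ∈ V, ((Fintype.card D : ℝ≥0∞)⁻¹) ^ n := by
        gcongr
        exact bernoulli_digitPrefix_eq_le he n _
    _ = 4 ^ Fintype.card ι * ((Fintype.card D : ℝ≥0∞)⁻¹) ^ n := by simp [hV]

end Bernoulli

theorem le_dimH_of_mapsTo_digitMap [Fintype D] [Nonempty D] [Fintype ι] (hb : 1 < b)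
    {e : D → ι → Fin b} (he : Function.Injective e) {d : ℝ≥0}
    (hd : (Fintype.card D : ℝ≥0) = (b : ℝ≥0) ^ (d : ℝ)) {G : Set (ι → ℝ)}
    (hne : G.Nonempty) (hG : IsClosed G) (hGe : ∀ c, MapsTo (digitMap e c) G G) :
    (d : ℝ≥0∞) ≤ dimH G := by
  let _ : MeasurableSpace D := ⊤
  refine le_dimH_of_measure_closedEBall_pow_le (μ := (bernoulli D).map (digitPoint e))
    (C := 4 ^ Fintype.card ι) (β := (b : ℝ≥0)⁻¹) (by positivity)
    (inv_lt_one_of_one_lt₀ (by exact_mod_cast hb)) (fun x n => ?_) ?_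
  · rw [closedEBall_coe, Measure.map_apply (measurable_digitPoint e) measurableSet_closedBall,
      NNReal.inv_rpow, ← hd, ENNReal.coe_pow (Fintype.card D : ℝ≥0)⁻¹,
      ENNReal.coe_inv (by simp)]
    simpa using bernoulli_preimage_closedBall_le he x n
  · have hG1 : digitPoint e ⁻¹' G = univ :=
      preimage_eq_univ_iff.2 (range_digitPoint_subset hb hne hG hGe)
    rw [Measure.map_apply (measurable_digitPoint e) hG.measurableSet, hG1, measure_univ]
    exact one_ne_zero

end DigitPoints

section LowerBound

theorem two_rpow_two_mul_log_three_div_log_two :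
    (2 : ℝ) ^ (2 * (Real.log 3 / Real.log 2)) = 9 := by
  have hlog3 : (2 : ℝ) ^ (Real.log 3 / Real.log 2) = 3 :=
    Real.rpow_logb (by norm_num) (by norm_num) (by norm_num)
  rw [mul_comm, Real.rpow_mul (by norm_num), hlog3]
  norm_num

theorem isCompact_gasketProd (p q : Fin 3 → Plane) : IsCompact (gasketProd p q) := by
  have himage : gasketProd p q = WithLp.toLp 2 '' (gasket p ×ˢ gasket q) := by
    ext y
    exact ⟨fun hy => ⟨(y.fst, y.snd), hy, rfl⟩, by rintro ⟨_, hz, rfl⟩; exact hz⟩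
  rw [himage]
  exact ((isAttractor_gasket p).2.1.prod (isAttractor_gasket q).2.1).image
    (WithLp.prod_continuous_toLp 2 Plane Plane)

theorem gasketProd_nonempty (p q : Fin 3 → Plane) : (gasketProd p q).Nonempty := by
  obtain ⟨t, ht⟩ := (isAttractor_gasket p).1
  obtain ⟨u, hu⟩ := (isAttractor_gasket q).1
  exact ⟨WithLp.toLp 2 (t, u), ht, hu⟩

theorem halfMap_mem_gasket {p : Fin 3 → Plane} {t : Plane} (ht : t ∈ gasket p) (i : Fin 3) :
    halfMap p i t ∈ gasket p := by
  rw [(isAttractor_gasket p).2.2]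
  exact mem_iUnion.2 ⟨i, t, ht, rfl⟩

/-- The vertices of a triangle as an affine basis of the plane, so that points have barycentric
coordinates. -/
noncomputable def triangleBasis (P : Affine.Triangle ℝ Plane) : AffineBasis (Fin 3) ℝ Plane where
  toFun := P.points
  ind' := P.independent
  tot' := by
    rw [P.independent.affineSpan_eq_top_iff_card_eq_finrank_add_one]
    simp

theorem triangleBasis_coord_halfMap (P : Affine.Triangle ℝ Plane) (i j : Fin 3) (t : Plane) :
    (triangleBasis P).coord i (halfMap P.points j t) =
      ((triangleBasis P).coord i t + if i = j then 1 else 0) / 2 := by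
  have hmid : halfMap P.points j t = midpoint ℝ t (triangleBasis P j) := by
    rw [midpoint_eq_smul_add, halfMap, invOf_eq_inv, one_div]
    rfl
  rw [hmid, AffineMap.map_midpoint, AffineBasis.coord_apply, midpoint_eq_smul_add, invOf_eq_inv,
    smul_eq_mul, inv_mul_eq_div]

/-- The barycentric coordinates of the two components with respect to two triangles. They turn the
product of the gaskets into a set of points with prescribed binary digits. -/
noncomputable def barycentric (P Q : Affine.Triangle ℝ Plane) (y : Plane2) : Fin 3 ⊕ Fin 3 → ℝ :=
  Sum.elim (fun i => (triangleBasis P).coord i y.fst) (fun i => (triangleBasis Q).coord i y.snd)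

theorem contDiff_barycentric (P Q : Affine.Triangle ℝ Plane) : ContDiff ℝ 1 (barycentric P Q) := by
  have hcoord (T : Affine.Triangle ℝ Plane) (i : Fin 3) :
      ContDiff ℝ 1 ((triangleBasis T).coord i) :=
    ContinuousAffineMap.contDiff ⟨_, ((triangleBasis T).coord i).continuous_of_finiteDimensional⟩
  refine contDiff_pi.2 ?_
  rintro (i | i)
  · exact (hcoord P i).comp (WithLp.fstL 2 ℝ Plane Plane).contDiff
  · exact (hcoord Q i).comp (WithLp.sndL 2 ℝ Plane Plane).contDiff

/-- The binary digits of barycentric coordinates prepended by applying `halfMap P.points c.1` and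
`halfMap Q.points c.2`: a one at the two chosen vertices, zeros elsewhere. -/
def vertexDigits (c : Fin 3 × Fin 3) : Fin 3 ⊕ Fin 3 → Fin 2 :=
  Sum.elim (fun i => if i = c.1 then 1 else 0) (fun i => if i = c.2 then 1 else 0)

theorem vertexDigits_injective : Function.Injective vertexDigits := by
  decide

theorem digitMap_vertexDigits_barycentric (P Q : Affine.Triangle ℝ Plane) (c : Fin 3 × Fin 3)
    (y : Plane2) :
    digitMap vertexDigits c (barycentric P Q y) = barycentric P Q
      (WithLp.toLp 2 (halfMap P.points c.1 y.fst, halfMap Q.points c.2 y.snd)) := by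
  funext i
  rcases i with i | i <;>
    simp [digitMap, vertexDigits, barycentric, triangleBasis_coord_halfMap, apply_ite Fin.val]

theorem le_dimH_gasketProd (P Q : Affine.Triangle ℝ Plane) :
    ENNReal.ofReal (2 * (Real.log 3 / Real.log 2)) ≤ dimH (gasketProd P.points Q.points) := by
  have hcard : (Fintype.card (Fin 3 × Fin 3) : ℝ≥0) =
      ((2 : ℕ) : ℝ≥0) ^ ((2 * (Real.log 3 / Real.log 2)).toNNReal : ℝ) := by
    rw [Real.coe_toNNReal _ (by positivity), ← NNReal.coe_inj, NNReal.coe_rpow]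
    simpa using two_rpow_two_mul_log_three_div_log_two.symm
  calc ENNReal.ofReal (2 * (Real.log 3 / Real.log 2))
      ≤ dimH (barycentric P Q '' gasketProd P.points Q.points) := by
        refine le_dimH_of_mapsTo_digitMap one_lt_two vertexDigits_injective hcard
          ((gasketProd_nonempty _ _).image _)
          ((isCompact_gasketProd _ _).image (contDiff_barycentric P Q).continuous).isClosed ?_
        rintro c _ ⟨y, hy, rfl⟩
        exact ⟨WithLp.toLp 2 (halfMap P.points c.1 y.fst, halfMap Q.points c.2 y.snd),
          ⟨halfMap_mem_gasket hy.1 c.1, halfMap_mem_gasket hy.2 c.2⟩,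
          (digitMap_vertexDigits_barycentric P Q c y).symm⟩
    _ ≤ dimH (gasketProd P.points Q.points) :=
        (contDiff_barycentric P Q).contDiffOn.dimH_image_le convex_univ (subset_univ _)

theorem dimH_le_dimH_graphOver (A : Set Plane2) (f : Plane2 → ℝ) :
    dimH A ≤ dimH (graphOver A f) := by
  have hfst : WithLp.fstL 2 ℝ Plane2 ℝ '' graphOver A f = A := by
    simp [graphOver, image_image]
  calc dimH A = dimH (WithLp.fstL 2 ℝ Plane2 ℝ '' graphOver A f) := by rw [hfst]
    _ ≤ dimH (graphOver A f) := (WithLp.fstL 2 ℝ Plane2 ℝ).lipschitz.dimH_image_le _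

end LowerBound

section Cells

variable {X ι : Type*}

/-- The image of `A` under `F (w 0) ∘ ⋯ ∘ F (w (n - 1))`: the piece of level `n`, with address `w`,
of a set `A` that is self-similar for the maps `F`. -/
def cell (F : ι → X → X) (A : Set X) : ∀ {n : ℕ}, (Fin n → ι) → Set X
  | 0, _ => A
  | _ + 1, w => F (w 0) '' cell F A (Fin.tail w)

variable {F : ι → X → X} {A : Set X}

theorem cell_subset (hFA : ∀ i, MapsTo (F i) A A) : ∀ {n : ℕ} (w : Fin n → ι), cell F A w ⊆ A
  | 0, _ => Subset.rfl
  | _ + 1, w => ((hFA (w 0)).mono_left (cell_subset hFA (Fin.tail w))).image_subset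

theorem subset_iUnion_cell (hA : A ⊆ ⋃ i, F i '' A) (n : ℕ) :
    A ⊆ ⋃ w : Fin n → ι, cell F A w := by
  induction n with
  | zero => exact fun y hy => mem_iUnion.2 ⟨Fin.elim0, hy⟩
  | succ n ih =>
    intro y hy
    obtain ⟨i, z, hz, rfl⟩ := mem_iUnion.1 (hA hy)
    obtain ⟨w, hw⟩ := mem_iUnion.1 (ih hz)
    refine mem_iUnion.2 ⟨Fin.cons i w, ?_⟩
    rw [cell, Fin.cons_zero, Fin.tail_cons]
    exact mem_image_of_mem _ hw

variable [PseudoMetricSpace X]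

theorem dist_le_of_mem_cell {ρ : ℝ≥0} (hF : ∀ i, LipschitzWith ρ (F i)) {R : ℝ}
    (hR : ∀ y ∈ A, ∀ y' ∈ A, dist y y' ≤ R) {n : ℕ} (w : Fin n → ι) :
    ∀ y ∈ cell F A w, ∀ y' ∈ cell F A w, dist y y' ≤ R * ρ ^ n := by
  induction n with
  | zero => simpa [cell] using hR
  | succ n ih =>
    rintro _ ⟨y, hy, rfl⟩ _ ⟨y', hy', rfl⟩
    calc dist (F (w 0) y) (F (w 0) y') ≤ ρ * dist y y' := (hF (w 0)).dist_le_mul y y'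
      _ ≤ ρ * (R * ρ ^ n) := by
        gcongr
        exact ih _ y hy y' hy'
      _ = R * ρ ^ (n + 1) := by ring

theorem abs_sub_le_of_mem_cell {ρ : ℝ≥0} (hF : ∀ i, LipschitzWith ρ (F i))
    (hFA : ∀ i, MapsTo (F i) A A) {R : ℝ} (hR : ∀ y ∈ A, ∀ y' ∈ A, dist y y' ≤ R) {f : X → ℝ}
    {a K s O : ℝ} (ha : 0 ≤ a) (hK : 0 ≤ K) (hs : 0 ≤ s)
    (hf : ∀ i, ∀ y ∈ A, ∀ y' ∈ A, |f (F i y) - f (F i y')| ≤ a * |f y - f y'| + K * dist y y' ^ s)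
    (hO : ∀ y ∈ A, ∀ y' ∈ A, |f y - f y'| ≤ O) (hstep : a * O + K * R ^ s ≤ O * ρ ^ s)
    {n : ℕ} (w : Fin n → ι) :
    ∀ y ∈ cell F A w, ∀ y' ∈ cell F A w, |f y - f y'| ≤ O * (ρ ^ n) ^ s := by
  induction n with
  | zero => simpa [cell] using hO
  | succ n ih =>
    rintro _ ⟨y, hy, rfl⟩ _ ⟨y', hy', rfl⟩
    have hyA := cell_subset hFA _ hy
    have hyA' := cell_subset hFA _ hy'
    have hR0 : 0 ≤ R := dist_nonneg.trans (hR y hyA y' hyA')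
    calc |f (F (w 0) y) - f (F (w 0) y')| ≤ a * |f y - f y'| + K * dist y y' ^ s :=
          hf (w 0) y hyA y' hyA'
      _ ≤ a * (O * (ρ ^ n) ^ s) + K * (R * ρ ^ n) ^ s := by
        gcongr
        · exact ih _ y hy y' hy'
        · exact dist_le_of_mem_cell hF hR _ y hy y' hy'
      _ = (a * O + K * R ^ s) * (ρ ^ n) ^ s := by
        rw [Real.mul_rpow hR0 (by positivity)]
        ring
      _ ≤ O * ρ ^ s * (ρ ^ n) ^ s := by gcongr
      _ = O * (ρ ^ (n + 1)) ^ s := by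
        rw [pow_succ', Real.mul_rpow ρ.coe_nonneg (by positivity), mul_assoc]

/-- Since `a < ρ ^ s`, a large enough constant absorbs the error term of the recursion. -/
theorem exists_abs_sub_le_of_mem_cell {ρ : ℝ≥0} (hF : ∀ i, LipschitzWith ρ (F i))
    (hFA : ∀ i, MapsTo (F i) A A) {R : ℝ} (hR : ∀ y ∈ A, ∀ y' ∈ A, dist y y' ≤ R) {f : X → ℝ}
    {a K s M : ℝ} (ha : 0 ≤ a) (hK : 0 ≤ K) (hs : 0 ≤ s) (haρ : a < ρ ^ s)
    (hf : ∀ i, ∀ y ∈ A, ∀ y' ∈ A, |f (F i y) - f (F i y')| ≤ a * |f y - f y'| + K * dist y y' ^ s)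
    (hM : ∀ y ∈ A, |f y| ≤ M) :
    ∃ O : ℝ, 0 ≤ O ∧ ∀ (n : ℕ) (w : Fin n → ι), ∀ y ∈ cell F A w, ∀ y' ∈ cell F A w,
      |f y - f y'| ≤ O * (ρ ^ n) ^ s := by
  have hgap : 0 < ρ ^ s - a := sub_pos.2 haρ
  refine ⟨max (max 0 (2 * M)) (K * R ^ s / (ρ ^ s - a)), by positivity, fun n w =>
    abs_sub_le_of_mem_cell hF hFA hR ha hK hs hf (fun y hy y' hy' => ?_) ?_ w⟩
  · calc |f y - f y'| ≤ |f y| + |f y'| := abs_sub _ _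
      _ ≤ 2 * M := by linarith [hM y hy, hM y' hy']
      _ ≤ _ := (le_max_right _ _).trans (le_max_left _ _)
  · have := (div_le_iff₀ hgap).1 (le_max_right (max 0 (2 * M)) (K * R ^ s / (ρ ^ s - a)))
    linarith

end Cells

section GraphCover

open Metric

theorem dist_le_dist_fst_add_dist_snd {E F : Type*} [SeminormedAddCommGroup E]
    [SeminormedAddCommGroup F] (x y : WithLp 2 (E × F)) :
    dist x y ≤ dist x.fst y.fst + dist x.snd y.snd := by
  rw [WithLp.prod_dist_eq_of_L2, Real.sqrt_le_left (by positivity), add_sq]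
  nlinarith [mul_nonneg (dist_nonneg (x := x.fst) (y := y.fst))
    (dist_nonneg (x := x.snd) (y := y.snd))]

theorem exists_finset_forall_Icc_abs_sub_le (a : ℝ) {L ε : ℝ} (hL : 0 ≤ L) (hε : 0 < ε) :
    ∃ C : Finset ℝ, (C.card : ℝ) ≤ L / ε + 1 ∧ ∀ x ∈ Icc a (a + L), ∃ c ∈ C, |x - c| ≤ ε := by
  refine ⟨(Finset.range (⌊L / ε⌋₊ + 1)).image fun k : ℕ => a + k * ε, ?_, fun x hx => ?_⟩
  · calc (((Finset.range (⌊L / ε⌋₊ + 1)).image fun k : ℕ => a + k * ε).card : ℝ)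
        ≤ (⌊L / ε⌋₊ + 1 : ℕ) := by
          exact_mod_cast Finset.card_image_le.trans_eq (Finset.card_range _)
      _ ≤ L / ε + 1 := by
          push_cast
          gcongr
          exact Nat.floor_le (by positivity)
  · have hk : (⌊(x - a) / ε⌋₊ : ℝ) * ε ≤ x - a :=
      (le_div_iff₀ hε).1 (Nat.floor_le (div_nonneg (sub_nonneg.2 hx.1) hε.le))
    have hk' : x - a < (⌊(x - a) / ε⌋₊ + 1) * ε := (div_lt_iff₀ hε).1 (Nat.lt_floor_add_one _)
    refine ⟨a + ⌊(x - a) / ε⌋₊ * ε, Finset.mem_image_of_mem _ (Finset.mem_range.2 ?_), ?_⟩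
    · refine Nat.lt_succ_of_le (Nat.floor_le_floor ?_)
      gcongr
      linarith [hx.2]
    · rw [abs_le]
      constructor <;> linarith

theorem externalCoveringNumber_graphOver_le {E : Set Plane2} {f : Plane2 → ℝ} {δ : ℝ≥0} {H : ℝ}
    (hδ : 0 < δ) (hE : ∀ y ∈ E, ∀ y' ∈ E, dist y y' ≤ δ / 2)
    (hf : ∀ y ∈ E, ∀ y' ∈ E, |f y - f y'| ≤ H) :
    (externalCoveringNumber δ (graphOver E f) : ℝ≥0∞) ≤ ENNReal.ofReal (4 * H / δ + 1) := by
  rcases E.eq_empty_or_nonempty with rfl | ⟨y₀, hy₀⟩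
  · simp [graphOver]
  have hH : 0 ≤ H := (abs_nonneg _).trans (hf y₀ hy₀ y₀ hy₀)
  obtain ⟨C, hcard, hC⟩ := exists_finset_forall_Icc_abs_sub_le (f y₀ - H)
    (L := 2 * H) (ε := δ / 2) (by positivity) (by positivity)
  have hcover : IsCover δ (graphOver E f)
      ((fun c => (WithLp.toLp 2 (y₀, c) : Space5)) '' (C : Set ℝ)) := by
    rw [isCover_iff_subset_iUnion_closedBall]
    rintro _ ⟨y, hy, rfl⟩
    have hy' := abs_le.1 (hf y hy y₀ hy₀)
    obtain ⟨c, hc, hyc⟩ := hC (f y) ⟨by linarith, by linarith⟩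
    refine mem_iUnion₂.2 ⟨_, mem_image_of_mem _ (Finset.mem_coe.2 hc), ?_⟩
    calc dist (WithLp.toLp 2 (y, f y) : Space5) (WithLp.toLp 2 (y₀, c))
        ≤ dist y y₀ + dist (f y) c := dist_le_dist_fst_add_dist_snd _ _
      _ ≤ δ / 2 + δ / 2 := add_le_add (hE y hy y₀ hy₀) hyc
      _ = δ := add_halves _
  calc (externalCoveringNumber δ (graphOver E f) : ℝ≥0∞)
      ≤ C.card := by
        have hle := hcover.externalCoveringNumber_le_encard.trans (encard_image_le _ _)
        rw [encard_coe_eq_coe_finsetCard] at hle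
        exact_mod_cast hle
    _ = ENNReal.ofReal C.card := (ENNReal.ofReal_natCast _).symm
    _ ≤ ENNReal.ofReal (4 * H / δ + 1) := by
        refine ENNReal.ofReal_le_ofReal (hcard.trans_eq ?_)
        field_simp
        ring

theorem externalCoveringNumber_graphOver_le_of_subset_iUnion {ι : Type*} [Fintype ι]
    {A : Set Plane2} {E : ι → Set Plane2} (hA : A ⊆ ⋃ i, E i) {f : Plane2 → ℝ} {δ : ℝ≥0} {H : ℝ}
    (hδ : 0 < δ) (hE : ∀ i, ∀ y ∈ E i, ∀ y' ∈ E i, dist y y' ≤ δ / 2)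
    (hf : ∀ i, ∀ y ∈ E i, ∀ y' ∈ E i, |f y - f y'| ≤ H) :
    (externalCoveringNumber δ (graphOver A f) : ℝ≥0∞) ≤
      ENNReal.ofReal (Fintype.card ι * (4 * H / δ + 1)) := by
  have hgraph : graphOver A f ⊆ ⋃ i, graphOver (E i) f := by
    simp only [graphOver, ← image_iUnion]
    exact image_mono hA
  have hsum : externalCoveringNumber δ (graphOver A f) ≤
      ∑ i, externalCoveringNumber δ (graphOver (E i) f) :=
    (externalCoveringNumber_mono_set hgraph).trans (externalCoveringNumber_iUnion_le _ _)
  calc (externalCoveringNumber δ (graphOver A f) : ℝ≥0∞)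
      ≤ ∑ i, (externalCoveringNumber δ (graphOver (E i) f) : ℝ≥0∞) :=
        (ENat.toENNReal_le.2 hsum).trans_eq (map_sum ENat.toENNRealRingHom _ _)
    _ ≤ ∑ _i : ι, ENNReal.ofReal (4 * H / δ + 1) :=
        Finset.sum_le_sum fun i _ => externalCoveringNumber_graphOver_le hδ (hE i) (hf i)
    _ = ENNReal.ofReal (Fintype.card ι * (4 * H / δ + 1)) := by
        rw [ENNReal.ofReal_mul (by positivity)]
        simp

theorem rpow_neg_mul_le_of_mem_Icc {r δ c₁ c₂ O s D : ℝ} (hδ : 0 < δ) (hδ1 : δ ≤ 1) (hc₁ : 0 < c₁)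
    (hr : r ∈ Icc (c₁ * δ) (c₂ * δ)) (hO : 0 ≤ O) (hs0 : 0 ≤ s) (hs1 : s ≤ 1) (hD : 0 ≤ D) :
    r ^ (-D) * (4 * (O * r ^ s) / δ + 1) ≤
      c₁ ^ (-D) * (4 * O * c₂ ^ s + 1) * δ ^ (-(1 - s + D)) := by
  have hr0 : 0 < r := (mul_pos hc₁ hδ).trans_le hr.1
  have hc₂ : 0 < c₂ := pos_of_mul_pos_left (hr0.trans_le hr.2) hδ.le
  have hcount : r ^ (-D) ≤ c₁ ^ (-D) * δ ^ (-D) := by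
    rw [← Real.mul_rpow hc₁.le hδ.le]
    exact Real.rpow_le_rpow_of_nonpos (by positivity) hr.1 (neg_nonpos.2 hD)
  have hone : 1 ≤ δ ^ (s - 1) :=
    Real.one_le_rpow_of_pos_of_le_one_of_nonpos hδ hδ1 (sub_nonpos.2 hs1)
  have hosc : 4 * (O * r ^ s) / δ + 1 ≤ (4 * O * c₂ ^ s + 1) * δ ^ (s - 1) := by
    calc 4 * (O * r ^ s) / δ + 1 ≤ 4 * (O * (c₂ * δ) ^ s) / δ + δ ^ (s - 1) := by
          gcongr
          exact hr.2
      _ = (4 * O * c₂ ^ s + 1) * δ ^ (s - 1) := by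
          rw [Real.mul_rpow hc₂.le hδ.le, Real.rpow_sub_one hδ.ne']
          ring
  calc r ^ (-D) * (4 * (O * r ^ s) / δ + 1)
      ≤ c₁ ^ (-D) * δ ^ (-D) * ((4 * O * c₂ ^ s + 1) * δ ^ (s - 1)) := by gcongr
    _ = c₁ ^ (-D) * (4 * O * c₂ ^ s + 1) * δ ^ (-(1 - s + D)) := by
        rw [show -(1 - s + D) = -D + (s - 1) by ring, Real.rpow_add hδ]
        ring

theorem upperBoxDim_graphOver_le {A : Set Plane2} {J : ℕ → Type*} [∀ n, Fintype (J n)]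
    {E : ∀ n, J n → Set Plane2} {f : Plane2 → ℝ} {ρ R O s D : ℝ} (hρ0 : 0 < ρ) (hρ1 : ρ < 1)
    (hR : 0 < R) (hO : 0 ≤ O) (hs0 : 0 ≤ s) (hs1 : s ≤ 1) (hD : 0 ≤ D)
    (hA : ∀ n, A ⊆ ⋃ j, E n j) (hcard : ∀ n, (Fintype.card (J n) : ℝ) ≤ (ρ ^ n) ^ (-D))
    (hE : ∀ n j, ∀ y ∈ E n j, ∀ y' ∈ E n j, dist y y' ≤ R * ρ ^ n)
    (hf : ∀ n j, ∀ y ∈ E n j, ∀ y' ∈ E n j, |f y - f y'| ≤ O * (ρ ^ n) ^ s) :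
    upperBoxDim (graphOver A f) ≤ ((1 - s + D : ℝ) : EReal) := by
  refine upperBoxDim_le_of_eventually_externalCoveringNumber_le
    (C := (ρ / (2 * R)) ^ (-D) * (4 * O * (1 / (2 * R)) ^ s + 1)) (by positivity) ?_
  have hsmall : ∀ᶠ δ : ℝ≥0 in 𝓝[>] 0, (δ : ℝ) < min 1 (2 * R) :=
    (NNReal.continuous_coe.tendsto 0).mono_left nhdsWithin_le_nhds |>.eventually_lt_const
      (by simpa using hR)
  filter_upwards [self_mem_nhdsWithin, hsmall] with δ hδ hδR
  have hδ0 : (0 : ℝ) < δ := by exact_mod_cast hδ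
  obtain ⟨n, hn, hn'⟩ := exists_nat_pow_near_of_lt_one (x := δ / (2 * R)) (by positivity)
    ((div_le_one (by positivity)).2 (hδR.trans_le (min_le_right _ _)).le) hρ0 hρ1
  have hmesh : ρ ^ (n + 1) ∈ Icc (ρ / (2 * R) * δ) (1 / (2 * R) * δ) := by
    refine ⟨?_, hn.le.trans_eq (by ring)⟩
    calc ρ / (2 * R) * δ = ρ * (δ / (2 * R)) := by ring
      _ ≤ ρ * ρ ^ n := by gcongr
      _ = ρ ^ (n + 1) := (pow_succ' ρ n).symm
  have hdiam : R * ρ ^ (n + 1) ≤ δ / 2 := by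
    calc R * ρ ^ (n + 1) ≤ R * (δ / (2 * R)) := by gcongr
      _ = δ / 2 := by field_simp
  refine (externalCoveringNumber_graphOver_le_of_subset_iUnion (hA (n + 1)) hδ
    (fun j y hy y' hy' => (hE _ j y hy y' hy').trans hdiam) (hf (n + 1))).trans
    (ENNReal.ofReal_le_ofReal ?_)
  calc Fintype.card (J (n + 1)) * (4 * (O * (ρ ^ (n + 1)) ^ s) / δ + 1)
      ≤ (ρ ^ (n + 1)) ^ (-D) * (4 * (O * (ρ ^ (n + 1)) ^ s) / δ + 1) := by
        gcongr
        exact hcard (n + 1)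
    _ ≤ _ := rpow_neg_mul_le_of_mem_Icc hδ0 (hδR.trans_le (min_le_left _ _)).le (by positivity)
        hmesh hO hs0 hs1 hD

end GraphCover

section Holder

open Metric

variable {X Y : Type*} [PseudoMetricSpace X] [PseudoMetricSpace Y] {A : Set X}

theorem isBounded_image_of_holderOnWith (hA : Bornology.IsBounded A) {C r : ℝ≥0} {g : X → Y}
    (hg : HolderOnWith C r g A) : Bornology.IsBounded (g '' A) := by
  rw [isBounded_iff_ediam_ne_top] at hA ⊢
  exact ne_top_of_le_ne_top (by finiteness) hg.ediam_image_le

theorem exists_holderOnWith_of_forall_le {ι : Type*} [Finite ι] (hA : Bornology.IsBounded A)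
    {K r : ι → ℝ≥0} {s : ℝ≥0} (hs : ∀ i, s ≤ r i) {g : ι → X → Y}
    (hg : ∀ i, HolderOnWith (K i) (r i) (g i) A) :
    ∃ C : ℝ≥0, ∀ i, HolderOnWith C s (g i) A := by
  have hD : ∀ x ∈ A, ∀ y ∈ A, edist x y ≤ (ediam A).toNNReal := fun x hx y hy => by
    rw [ENNReal.coe_toNNReal (isBounded_iff_ediam_ne_top.1 hA)]
    exact edist_le_ediam_of_mem hx hy
  obtain ⟨C, hC⟩ := (finite_range fun i =>
    K i * (ediam A).toNNReal ^ (r i - s : ℝ)).bddAbove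
  exact ⟨C, fun i => ((hg i).of_le hD (hs i)).mono_const (hC (mem_range_self i))⟩

end Holder

section UpperBound

theorem dist_wordMap (p : Fin 3 → Plane) {N : ℕ} (ω : Word N) (t t' : Plane) :
    dist (wordMap p ω t) (wordMap p ω t') = (1 / 2) ^ N * dist t t' := by
  have hfoldr (l : List (Fin 3)) : dist (l.foldr (halfMap p) t) (l.foldr (halfMap p) t') =
      (1 / 2) ^ l.length * dist t t' := by
    induction l with
    | nil => simp
    | cons i l ih =>
      rw [List.foldr_cons, List.foldr_cons, halfMap, halfMap, dist_smul₀, dist_add_right, ih,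
        Real.norm_of_nonneg (by norm_num), List.length_cons, pow_succ', mul_assoc]
  simpa [wordMap] using hfoldr (List.ofFn ω)

/-- The map `(t, u) ↦ (L_ω(t), K_η(u))`, the action of `fifSystem` on the base. -/
noncomputable def wordMap2 (p q : Fin 3 → Plane) {N : ℕ} (w : Word N × Word N) (y : Plane2) :
    Plane2 :=
  WithLp.toLp 2 (wordMap p w.1 y.fst, wordMap q w.2 y.snd)

theorem dist_wordMap2 (p q : Fin 3 → Plane) {N : ℕ} (w : Word N × Word N) (y y' : Plane2) :
    dist (wordMap2 p q w y) (wordMap2 p q w y') = (1 / 2) ^ N * dist y y' := by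
  rw [WithLp.prod_dist_eq_of_L2, WithLp.prod_dist_eq_of_L2]
  simp only [wordMap2, WithLp.toLp_fst, WithLp.toLp_snd, dist_wordMap]
  rw [mul_pow, mul_pow, ← mul_add, Real.sqrt_mul (by positivity), Real.sqrt_sq (by positivity)]

theorem lipschitzWith_wordMap2 (p q : Fin 3 → Plane) {N : ℕ} (w : Word N × Word N) :
    LipschitzWith ((1 / 2) ^ N) (wordMap2 p q w) :=
  .of_dist_le_mul fun y y' => by simpa using (dist_wordMap2 p q w y y').le

theorem card_word_prod_word (N : ℕ) :
    (Fintype.card (Word N × Word N) : ℝ) =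
      ((1 / 2 : ℝ) ^ N) ^ (-(2 * (Real.log 3 / Real.log 2))) := by
  calc (Fintype.card (Word N × Word N) : ℝ) = 9 ^ N := by
        rw [Fintype.card_prod, Fintype.card_fun, Fintype.card_fin, Fintype.card_fin, ← mul_pow]
        norm_num
    _ = ((2 : ℝ) ^ (2 * (Real.log 3 / Real.log 2))) ^ N := by
        rw [two_rpow_two_mul_log_three_div_log_two]
    _ = ((1 / 2 : ℝ) ^ N) ^ (-(2 * (Real.log 3 / Real.log 2))) := by
        rw [Real.rpow_pow_comm (by norm_num), one_div, inv_pow, Real.rpow_neg_eq_inv_rpow, inv_inv]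

theorem supNorm_nonneg {N : ℕ} (A : Set Plane2) (α : Word N × Word N → Plane2 → ℝ) :
    0 ≤ supNorm A α :=
  Real.iSup_nonneg fun _ => Real.iSup_nonneg fun _ => abs_nonneg _

theorem abs_le_supNorm {N : ℕ} {A : Set Plane2} {α : Word N × Word N → Plane2 → ℝ}
    (hα : ∀ w, Bornology.IsBounded (α w '' A)) (w : Word N × Word N) {y : Plane2} (hy : y ∈ A) :
    |α w y| ≤ supNorm A α := by
  obtain ⟨B, hB⟩ := (hα w).exists_norm_le
  have hbdd : BddAbove (range fun y : A => |α w y|) :=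
    ⟨B, by rintro _ ⟨z, rfl⟩; exact hB _ (mem_image_of_mem _ z.2)⟩
  calc |α w y| ≤ ⨆ y : A, |α w y| := le_ciSup hbdd ⟨y, hy⟩
    _ ≤ supNorm A α := le_ciSup (f := fun w => ⨆ y : A, |α w y|) (finite_range _).bddAbove w

namespace IsFIF

variable {p q : Fin 3 → Plane} {N : ℕ} {α h : Word N × Word N → Plane2 → ℝ} {f : Plane2 → ℝ}

theorem wordMap2_mem_and_apply (hf : IsFIF p q α h f) (w : Word N × Word N) {y : Plane2}
    (hy : y ∈ gasketProd p q) :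
    wordMap2 p q w y ∈ gasketProd p q ∧ f (wordMap2 p q w y) = α w y * f y + h w y := by
  have hmem : fifSystem p q α h w (WithLp.toLp 2 (y, f y)) ∈ graphOver (gasketProd p q) f := by
    rw [hf.2.2]
    exact mem_iUnion.2 ⟨w, _, mem_image_of_mem _ hy, rfl⟩
  obtain ⟨z, hz, hzw⟩ := hmem
  have hbase : z = wordMap2 p q w y := congrArg WithLp.fst hzw
  have hvalue : f z = α w y * f y + h w y := congrArg WithLp.snd hzw
  exact hbase ▸ ⟨hz, hvalue⟩

theorem mapsTo_wordMap2 (hf : IsFIF p q α h f) (w : Word N × Word N) :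
    MapsTo (wordMap2 p q w) (gasketProd p q) (gasketProd p q) :=
  fun _ hy => (hf.wordMap2_mem_and_apply w hy).1

theorem apply_wordMap2 (hf : IsFIF p q α h f) (w : Word N × Word N) {y : Plane2}
    (hy : y ∈ gasketProd p q) : f (wordMap2 p q w y) = α w y * f y + h w y :=
  (hf.wordMap2_mem_and_apply w hy).2

theorem subset_iUnion_wordMap2 (hf : IsFIF p q α h f) :
    gasketProd p q ⊆ ⋃ w : Word N × Word N, wordMap2 p q w '' gasketProd p q := by
  intro y hy
  have hmem : (WithLp.toLp 2 (y, f y) : Space5) ∈ graphOver (gasketProd p q) f :=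
    mem_image_of_mem _ hy
  rw [hf.2.2] at hmem
  obtain ⟨w, _, ⟨z, hz, rfl⟩, hzw⟩ := mem_iUnion.1 hmem
  exact mem_iUnion.2 ⟨w, z, hz, congrArg WithLp.fst hzw⟩

theorem exists_abs_le (hf : IsFIF p q α h f) :
    ∃ M : ℝ, 0 ≤ M ∧ ∀ y ∈ gasketProd p q, |f y| ≤ M := by
  obtain ⟨M, hM0, hM⟩ :=
    (hf.2.1.image (WithLp.sndL 2 ℝ Plane2 ℝ).continuous).isBounded.exists_pos_norm_le
  exact ⟨M, hM0.le, fun y hy => hM _ (mem_image_of_mem _ (mem_image_of_mem _ hy))⟩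

theorem abs_sub_wordMap2_le (hf : IsFIF p q α h f) {Kα Kh s : ℝ≥0}
    (hα : ∀ w, HolderOnWith Kα s (α w) (gasketProd p q))
    (hh : ∀ w, HolderOnWith Kh s (h w) (gasketProd p q)) {a M : ℝ}
    (ha : ∀ w, ∀ y ∈ gasketProd p q, |α w y| ≤ a) (hM : ∀ y ∈ gasketProd p q, |f y| ≤ M)
    (w : Word N × Word N) {y y' : Plane2} (hy : y ∈ gasketProd p q) (hy' : y' ∈ gasketProd p q) :
    |f (wordMap2 p q w y) - f (wordMap2 p q w y')| ≤
      a * |f y - f y'| + (Kα * M + Kh) * dist y y' ^ (s : ℝ) := by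
  rw [hf.apply_wordMap2 w hy, hf.apply_wordMap2 w hy']
  calc |α w y * f y + h w y - (α w y' * f y' + h w y')|
      = |α w y * (f y - f y') + (α w y - α w y') * f y' + (h w y - h w y')| := by
        congr 1
        ring
    _ ≤ |α w y| * |f y - f y'| + |α w y - α w y'| * |f y'| + |h w y - h w y'| := by
        rw [← abs_mul, ← abs_mul]
        exact abs_add_three _ _ _
    _ ≤ a * |f y - f y'| + Kα * dist y y' ^ (s : ℝ) * M + Kh * dist y y' ^ (s : ℝ) := by
        gcongr
        · exact ha w y hy
        · exact (hα w).dist_le hy hy'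
        · exact hM y' hy'
        · exact (hh w).dist_le hy hy'
    _ = a * |f y - f y'| + (Kα * M + Kh) * dist y y' ^ (s : ℝ) := by ring

theorem exists_abs_sub_le_of_mem_cell (hf : IsFIF p q α h f) {Kα Kh s : ℝ≥0} (hs : s ≤ 1)
    (hα : ∀ w, HolderOnWith Kα s (α w) (gasketProd p q))
    (hh : ∀ w, HolderOnWith Kh s (h w) (gasketProd p q))
    (hnorm : supNorm (gasketProd p q) α < 1 / 2 ^ N) {R : ℝ}
    (hR : ∀ y ∈ gasketProd p q, ∀ y' ∈ gasketProd p q, dist y y' ≤ R) :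
    ∃ O : ℝ, 0 ≤ O ∧ ∀ (n : ℕ) (v : Fin n → Word N × Word N),
      ∀ y ∈ cell (wordMap2 p q) (gasketProd p q) v, ∀ y' ∈ cell (wordMap2 p q) (gasketProd p q) v,
        |f y - f y'| ≤ O * (((1 / 2) ^ N) ^ n) ^ (s : ℝ) := by
  obtain ⟨M, hM0, hM⟩ := hf.exists_abs_le
  have hρ : (((1 / 2) ^ N : ℝ≥0) : ℝ) ≤ 1 := by
    push_cast
    exact pow_le_one₀ (by norm_num) (by norm_num)
  have hnorm' : supNorm (gasketProd p q) α < (((1 / 2) ^ N : ℝ≥0) : ℝ) ^ (s : ℝ) := by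
    calc supNorm (gasketProd p q) α < (((1 / 2) ^ N : ℝ≥0) : ℝ) := by simpa using hnorm
      _ ≤ (((1 / 2) ^ N : ℝ≥0) : ℝ) ^ (s : ℝ) :=
        Real.self_le_rpow_of_le_one (NNReal.coe_nonneg _) hρ (by exact_mod_cast hs)
  have hαbdd (w) : Bornology.IsBounded (α w '' gasketProd p q) :=
    isBounded_image_of_holderOnWith (isCompact_gasketProd p q).isBounded (hα w)
  simpa using GasketFIF.exists_abs_sub_le_of_mem_cell (lipschitzWith_wordMap2 p q)
    hf.mapsTo_wordMap2 hR (supNorm_nonneg _ α) (K := Kα * M + Kh) (by positivity) s.coe_nonneg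
    hnorm' (fun w y hy y' hy' => hf.abs_sub_wordMap2_le hα hh
      (fun w y hy => abs_le_supNorm hαbdd w hy) hM w hy hy') hM

theorem upperBoxDim_graphOver_le (hf : IsFIF p q α h f) (hN : 1 ≤ N) {Kα Kh s : ℝ≥0} (hs : s ≤ 1)
    (hα : ∀ w, HolderOnWith Kα s (α w) (gasketProd p q))
    (hh : ∀ w, HolderOnWith Kh s (h w) (gasketProd p q))
    (hnorm : supNorm (gasketProd p q) α < 1 / 2 ^ N) :
    upperBoxDim (graphOver (gasketProd p q) f) ≤
      ((1 - s + 2 * (Real.log 3 / Real.log 2) : ℝ) : EReal) := by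
  obtain ⟨R, hR0, hR⟩ : ∃ R : ℝ, 0 < R ∧
      ∀ y ∈ gasketProd p q, ∀ y' ∈ gasketProd p q, dist y y' ≤ R := by
    obtain ⟨R, hR⟩ := Metric.isBounded_iff.1 (isCompact_gasketProd p q).isBounded
    exact ⟨max R 1, by positivity, fun y hy y' hy' => (hR hy hy').trans (le_max_left _ _)⟩
  obtain ⟨O, hO, hosc⟩ := hf.exists_abs_sub_le_of_mem_cell hs hα hh hnorm hR
  refine GasketFIF.upperBoxDim_graphOver_le (J := fun n => Fin n → Word N × Word N)
    (E := fun _ => cell (wordMap2 p q) (gasketProd p q)) (ρ := (1 / 2) ^ N) (by positivity)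
    (pow_lt_one₀ (by norm_num) (by norm_num) (by omega)) hR0 hO s.coe_nonneg (by exact_mod_cast hs)
    (by positivity) (subset_iUnion_cell hf.subset_iUnion_wordMap2) (fun n => ?_)
    (fun n v => ?_) hosc
  · rw [Fintype.card_fun, Fintype.card_fin, Nat.cast_pow, card_word_prod_word,
      Real.rpow_pow_comm (by positivity)]
  · simpa using dist_le_of_mem_cell (lipschitzWith_wordMap2 p q) hR v

end IsFIF

end UpperBound

end GasketFIF

theorem mainTheorem3_general (P Q : Affine.Triangle ℝ Plane) (N : ℕ) (hN : 1 ≤ N)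
    (α h : Word N × Word N → Plane2 → ℝ) (f : Plane2 → ℝ) (hf : IsFIF P.points Q.points α h f)
    (Kh sh : ℝ≥0) (hsh : sh ≤ 1)
    (hh : ∀ w, HolderOnWith Kh sh (h w) (gasketProd P.points Q.points))
    (Kα sα : Word N × Word N → ℝ≥0)
    (hα : ∀ w, HolderOnWith (Kα w) (sα w) (α w) (gasketProd P.points Q.points))
    (hnorm : supNorm (gasketProd P.points Q.points) α < 1 / 2 ^ N)
    (s : ℝ) (hs : s = min (sh : ℝ) (⨅ w, (sα w : ℝ))) :
    ((2 * (Real.log 3 / Real.log 2) : ℝ) : EReal)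
        ≤ (dimH (graphOver (gasketProd P.points Q.points) f) : EReal) ∧
      (dimH (graphOver (gasketProd P.points Q.points) f) : EReal)
        ≤ upperBoxDim (graphOver (gasketProd P.points Q.points) f) ∧
      upperBoxDim (graphOver (gasketProd P.points Q.points) f)
        ≤ ((1 - s + 2 * (Real.log 3 / Real.log 2) : ℝ) : EReal) := by
  have hlower := (le_dimH_gasketProd P Q).trans (dimH_le_dimH_graphOver _ f)
  refine ⟨?_, dimH_le_upperBoxDim hf.1, ?_⟩
  · calc ((2 * (Real.log 3 / Real.log 2) : ℝ) : EReal)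
        ≤ (ENNReal.ofReal (2 * (Real.log 3 / Real.log 2)) : EReal) := by
          rw [EReal.coe_ennreal_ofReal]
          exact_mod_cast le_max_left _ _
      _ ≤ (dimH (graphOver (gasketProd P.points Q.points) f) : EReal) := by exact_mod_cast hlower
  lift s to ℝ≥0 using hs ▸ le_min sh.coe_nonneg (Real.iInf_nonneg fun w => (sα w).coe_nonneg)
  have hs_le_sh : s ≤ sh := by exact_mod_cast hs.trans_le (min_le_left _ _)
  have hs_le_sα (w) : s ≤ sα w := by
    exact_mod_cast hs.trans_le ((min_le_right _ _).trans (ciInf_le (finite_range _).bddBelow w))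
  have hbdd := (isCompact_gasketProd P.points Q.points).isBounded
  obtain ⟨Kα', hα'⟩ := exists_holderOnWith_of_forall_le hbdd hs_le_sα hα
  obtain ⟨Kh', hh'⟩ := exists_holderOnWith_of_forall_le hbdd (fun _ => hs_le_sh) hh
  exact hf.upperBoxDim_graphOver_le hN (hs_le_sh.trans hsh) hα' hh' hnorm

theorem mainTheorem3 (P Q : Affine.Triangle ℝ Plane) (hP : P.Equilateral) (hQ : Q.Equilateral)
    (N : ℕ) (hN : 1 ≤ N) (α h : Word N × Word N → Plane2 → ℝ) (f : Plane2 → ℝ)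
    (hf : IsFIF P.points Q.points α h f)
    (Kh sh : ℝ≥0) (hsh : 0 < sh ∧ sh ≤ 1)
    (hh : ∀ w, HolderOnWith Kh sh (h w) (gasketProd P.points Q.points))
    (Kα sα : Word N × Word N → ℝ≥0) (hsα : ∀ w, 0 < sα w ∧ sα w ≤ 1)
    (hα : ∀ w, HolderOnWith (Kα w) (sα w) (α w) (gasketProd P.points Q.points))
    (hnorm : supNorm (gasketProd P.points Q.points) α < 1 / 2 ^ N)
    (s : ℝ) (hs : s = min (sh : ℝ) (⨅ w, (sα w : ℝ))) :
    ((2 * (Real.log 3 / Real.log 2) : ℝ) : EReal)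
        ≤ (dimH (graphOver (gasketProd P.points Q.points) f) : EReal) ∧
      (dimH (graphOver (gasketProd P.points Q.points) f) : EReal)
        ≤ upperBoxDim (graphOver (gasketProd P.points Q.points) f) ∧
      upperBoxDim (graphOver (gasketProd P.points Q.points) f)
        ≤ ((1 - s + 2 * (Real.log 3 / Real.log 2) : ℝ) : EReal) :=
  mainTheorem3_general P Q N hN α h f hf Kh sh hsh.2 hh Kα sα hα hnorm s hs
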